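/- Let $\gamma$ denote the Euler–Mascheroni constant and set \[ \mathcal C = 1-\int_0^1\left(\frac{1}{t(e^t-1)}-\frac1{t^2}+\frac1{2t}\right)dt-\int_1^\infty\frac{dt}{t(e^t-1)}, \] where both integrals converge absolutely. Then $\mathcal C=\frac12(\log 2\pi-\gamma)$. Moreover, for all coprime integers $m,n\ge 1$, the integral on the left-hand side below converges absolutely and \[ mn\int_0^\infty\left(\frac1{mt}-\frac1{e^{mt}-1}\right)\left(\frac1{nt}-\frac1{e^{nt}-1}\right)dt = -\frac12+\mathcal C\,(n+m)+\frac{m-n}{2}\log\left(\frac nm\right) -\frac\pi2\sum_{k=1}^{n-1}\frac{mk}{n}\cot\left(\frac{mk\pi}{n}\right) -\frac\pi2\sum_{l=1}^{m-1}\frac{nl}{m}\cot\left(\frac{nl\pi}{m}\right), \] where empty sums are $0$. -/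

import Mathlib

open MeasureTheory Set

/-- The integrand `1/(t(e^t-1)) - 1/t^2 + 1/(2t)` on `(0,1]` in the definition of `vasyuninC`. -/
noncomputable def vasyuninNear (t : ℝ) : ℝ :=
  1 / (t * (Real.exp t - 1)) - 1 / t ^ 2 + 1 / (2 * t)

/-- The integrand `1/(t(e^t-1))` on `(1,∞)` in the definition of `vasyuninC`. -/
noncomputable def vasyuninFar (t : ℝ) : ℝ :=
  1 / (t * (Real.exp t - 1))

/-- The constant `C = 1 - ∫_0^1 (1/(t(e^t-1)) - 1/t^2 + 1/(2t)) dt - ∫_1^∞ dt/(t(e^t-1))`. -/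
noncomputable def vasyuninC : ℝ :=
  1 - (∫ t in Ioc (0 : ℝ) 1, vasyuninNear t) - ∫ t in Ioi (1 : ℝ), vasyuninFar t

/-- The function `t ↦ 1/(nt) - 1/(e^{nt}-1)`, for `t > 0`. -/
noncomputable def vasyuninE (n : ℕ) (t : ℝ) : ℝ :=
  1 / (n * t) - 1 / (Real.exp (n * t) - 1)

/-! Write B(t) = 1/(e^t - 1) and y = e^{-t}. Expanding the integrand leaves the product B(mt)B(nt),
that is 1/((1 - y^m)(1 - y^n)), as the only hard term. Its coefficients count the representations N
= am + bn; with mu + nv = 1, Popoviciu's formula gives them as N/(mn) - {uN/n} - {vN/m} + 1. Summing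
this back yields the partial fractions of `bose_mul_bose`: elementary terms in B, plus sums odd
under r ↦ n - r (and r ↦ m - r).

The odd sums integrate to cotangents (`integral_exp_sub_exp_div`), and multiplication by m or n
modulo the other turns these into the stated sums. What remains, `regularPart`, has explicit
integrals over (d, ∞) apart from ∫ B(t)/t, whose expansion as d → 0 defines `vasyuninC`; the
singular terms cancel in `tendsto_integral_regularPart`.

For the closed form of the constant, weighting by e^{-t} makes a Binet integral, evaluated by
telescoping against the Stirling sequence; the correction is an exponential integral, which
contributes γ through Γ'(1) = -γ. -/

open Filter Topology in
/-- The integrals over `(ε, ∞)` of an integrable function tend to the integral over `(0, ∞)`. -/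
theorem tendsto_integral_Ioi_nhdsGT_zero {f : ℝ → ℝ} (hf : IntegrableOn f (Ioi 0)) :
    Tendsto (fun ε => ∫ t in Ioi ε, f t) (𝓝[>] 0) (𝓝 (∫ t in Ioi 0, f t)) :=
  hf.continuousWithinAt_Ici_primitive_Ioi.mono_left (nhdsWithin_mono 0 Ioi_subset_Ici_self)

/-! ### Elementary bounds and absolute convergence -/

/-- The Bose–Einstein function `1 / (e^t - 1)`. -/
noncomputable def bose (t : ℝ) : ℝ := 1 / (Real.exp t - 1)

theorem exp_sub_one_pos {t : ℝ} (ht : 0 < t) : 0 < Real.exp t - 1 := by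
  have := Real.add_one_lt_exp ht.ne'
  linarith

theorem bose_pos {t : ℝ} (ht : 0 < t) : 0 < bose t := one_div_pos.2 (exp_sub_one_pos ht)

theorem bose_eq_exp_neg {t : ℝ} (ht : 0 < t) :
    bose t = Real.exp (-t) / (1 - Real.exp (-t)) := by
  have h := (exp_sub_one_pos ht).ne'
  have h' : 1 - Real.exp (-t) ≠ 0 := by
    have : Real.exp (-t) < 1 := by simpa using ht
    linarith
  rw [bose, div_eq_div_iff h h']
  have : Real.exp (-t) * Real.exp t = 1 := by rw [← Real.exp_add]; simp
  linarith

theorem bose_le_inv {t : ℝ} (ht : 0 < t) : bose t ≤ 1 / t :=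
  one_div_le_one_div_of_le ht (by linarith [Real.add_one_le_exp t])

/-- Clearing denominators leaves e^t(2 - t) ≤ 2 + t. The two sides agree at 0, and the derivative of
their difference, 1 - e^x(1 - x), is nonnegative because 1 - x ≤ e^{-x}. -/
theorem inv_sub_bose_le_half {t : ℝ} (ht : 0 < t) : 1 / t - bose t ≤ 1 / 2 := by
  have key : Real.exp t * (2 - t) ≤ 2 + t := by
    have hm : MonotoneOn (fun x : ℝ => 2 + x - Real.exp x * (2 - x)) (Ici 0) := by
      apply monotoneOn_of_hasDerivWithinAt_nonneg (f' := fun x => 1 - Real.exp x * (1 - x))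
        (convex_Ici 0) (by fun_prop)
      · intro x _
        have h := ((hasDerivAt_id x).const_add 2).sub
          ((Real.hasDerivAt_exp x).mul ((hasDerivAt_id x).const_sub 2))
        refine (h.congr_deriv ?_).hasDerivWithinAt
        simp; ring
      · intro x _
        have h1 : 1 - x ≤ Real.exp (-x) := by linarith [Real.add_one_le_exp (-x)]
        have h2 : Real.exp x * (1 - x) ≤ Real.exp x * Real.exp (-x) :=
          mul_le_mul_of_nonneg_left h1 (Real.exp_pos x).le
        rw [← Real.exp_add] at h2
        simp only [add_neg_cancel, Real.exp_zero] at h2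
        linarith
    have := hm self_mem_Ici ht.le ht.le
    norm_num at this
    linarith
  have h := exp_sub_one_pos ht
  rw [bose, div_sub_div _ _ ht.ne' h.ne', div_le_div_iff₀ (by positivity) two_pos]
  nlinarith

theorem half_sub_le_inv_sub_bose {t : ℝ} (ht : 0 < t) : 1 / 2 - t / 4 ≤ 1 / t - bose t := by
  have h1 : t + t ^ 2 / 2 ≤ Real.exp t - 1 := by linarith [Real.quadratic_le_exp_of_nonneg ht.le]
  have h2 : bose t ≤ 1 / (t + t ^ 2 / 2) := one_div_le_one_div_of_le (by positivity) h1
  have h3 : 1 / t - 1 / (t + t ^ 2 / 2) - (1 / 2 - t / 4) = t ^ 2 / (4 * (2 + t)) := by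
    field_simp
    ring
  have h4 : 0 ≤ t ^ 2 / (4 * (2 + t)) := by positivity
  linarith

theorem vasyuninNear_eq {t : ℝ} (ht : 0 < t) :
    vasyuninNear t = (1 / 2 - (1 / t - bose t)) / t := by
  have := (exp_sub_one_pos ht).ne'
  rw [vasyuninNear, bose]
  field_simp
  ring

theorem vasyuninNear_eq_bose {t : ℝ} (ht : 0 < t) :
    vasyuninNear t = bose t / t - 1 / t ^ 2 + 1 / (2 * t) := by
  rw [vasyuninNear_eq ht]
  field_simp
  ring

theorem vasyuninFar_eq (t : ℝ) : vasyuninFar t = bose t / t := by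
  rw [vasyuninFar, bose, div_div, mul_comm]

theorem vasyuninE_eq (n : ℕ) (t : ℝ) : vasyuninE n t = 1 / (n * t) - bose (n * t) := rfl

theorem vasyuninNear_nonneg {t : ℝ} (ht : 0 < t) : 0 ≤ vasyuninNear t := by
  rw [vasyuninNear_eq ht]
  exact div_nonneg (by linarith [inv_sub_bose_le_half ht]) ht.le

/-- The bound is uniform on (0, ∞), not only on (0, 1]; this is what later makes the Binet integrals
decay like 1/j. -/
theorem vasyuninNear_le {t : ℝ} (ht : 0 < t) : vasyuninNear t ≤ 1 / 4 := by
  rw [vasyuninNear_eq ht, div_le_iff₀ ht]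
  linarith [half_sub_le_inv_sub_bose ht]

@[fun_prop]
theorem measurable_bose : Measurable bose := by unfold bose; fun_prop

@[fun_prop]
theorem measurable_vasyuninNear : Measurable vasyuninNear := by unfold vasyuninNear; fun_prop

@[fun_prop]
theorem measurable_vasyuninFar : Measurable vasyuninFar := by unfold vasyuninFar; fun_prop

@[fun_prop]
theorem measurable_vasyuninE (n : ℕ) : Measurable (vasyuninE n) := by unfold vasyuninE; fun_prop

theorem integrableOn_vasyuninNear {a : ℝ} (ha : 0 ≤ a) (b : ℝ) :
    IntegrableOn vasyuninNear (Ioc a b) := by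
  refine Measure.integrableOn_of_bounded (M := 1 / 4) (by simp)
    measurable_vasyuninNear.aestronglyMeasurable ?_
  filter_upwards [ae_restrict_mem measurableSet_Ioc] with t ht
  have h0 : 0 < t := ha.trans_lt ht.1
  rw [Real.norm_of_nonneg (vasyuninNear_nonneg h0)]
  exact vasyuninNear_le h0

theorem integrableOn_inv_sq_Ioi {a : ℝ} (ha : 0 < a) :
    IntegrableOn (fun t : ℝ => 1 / t ^ 2) (Ioi a) := by
  refine (integrableOn_Ioi_rpow_of_lt (a := -2) (by norm_num) ha).congr_fun ?_ measurableSet_Ioi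
  intro t ht
  have : 0 < t := ha.trans ht
  simp [Real.rpow_neg this.le]

theorem integral_inv_sq_Ioi {a : ℝ} (ha : 0 < a) : ∫ t in Ioi a, 1 / t ^ 2 = 1 / a := by
  rw [← setIntegral_congr_fun (g := fun t : ℝ => 1 / t ^ 2) (f := fun t : ℝ => t ^ (-2 : ℝ))
    measurableSet_Ioi, integral_Ioi_rpow_of_lt (by norm_num) ha]
  · norm_num [Real.rpow_neg ha.le]
  · intro t ht
    have : 0 < t := ha.trans ht
    simp [Real.rpow_neg this.le]

theorem integrableOn_vasyuninFar {a : ℝ} (ha : 0 < a) : IntegrableOn vasyuninFar (Ioi a) := by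
  refine (integrableOn_inv_sq_Ioi ha).mono' measurable_vasyuninFar.aestronglyMeasurable ?_
  filter_upwards [ae_restrict_mem measurableSet_Ioi] with t ht
  have h0 : 0 < t := ha.trans ht
  rw [vasyuninFar_eq, Real.norm_of_nonneg (div_nonneg (bose_pos h0).le h0.le), div_le_iff₀ h0]
  refine (bose_le_inv h0).trans (le_of_eq ?_)
  field_simp

theorem vasyuninE_nonneg {n : ℕ} (hn : 1 ≤ n) {t : ℝ} (ht : 0 < t) : 0 ≤ vasyuninE n t := by
  have : (0 : ℝ) < n := by exact_mod_cast hn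
  rw [vasyuninE_eq]
  linarith [bose_le_inv (mul_pos this ht)]

theorem vasyuninE_le_one {n : ℕ} (hn : 1 ≤ n) {t : ℝ} (ht : 0 < t) : vasyuninE n t ≤ 1 := by
  have : (0 : ℝ) < n := by exact_mod_cast hn
  rw [vasyuninE_eq]
  linarith [inv_sub_bose_le_half (mul_pos this ht)]

theorem vasyuninE_le_inv {n : ℕ} (hn : 1 ≤ n) {t : ℝ} (ht : 0 < t) : vasyuninE n t ≤ 1 / t := by
  have h1 : (1 : ℝ) ≤ n := by exact_mod_cast hn
  have h2 : (0 : ℝ) < n := by linarith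
  rw [vasyuninE_eq]
  have h3 : 1 / (n * t) ≤ 1 / t := one_div_le_one_div_of_le ht (by nlinarith)
  linarith [bose_pos (mul_pos h2 ht)]

theorem integrableOn_vasyuninE_mul {m n : ℕ} (hm : 1 ≤ m) (hn : 1 ≤ n) :
    IntegrableOn (fun t => vasyuninE m t * vasyuninE n t) (Ioi 0) := by
  have hmeas : Measurable fun t => vasyuninE m t * vasyuninE n t := by fun_prop
  rw [← Ioc_union_Ioi_eq_Ioi zero_le_one]
  refine IntegrableOn.union ?_ ?_
  · refine Measure.integrableOn_of_bounded (M := 1) (by simp) hmeas.aestronglyMeasurable ?_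
    filter_upwards [ae_restrict_mem measurableSet_Ioc] with t ht
    have hm0 := vasyuninE_nonneg hm ht.1
    have hn0 := vasyuninE_nonneg hn ht.1
    rw [Real.norm_of_nonneg (mul_nonneg hm0 hn0)]
    exact mul_le_one₀ (vasyuninE_le_one hm ht.1) hn0 (vasyuninE_le_one hn ht.1)
  · refine (integrableOn_inv_sq_Ioi one_pos).mono' hmeas.aestronglyMeasurable ?_
    filter_upwards [ae_restrict_mem measurableSet_Ioi] with t ht
    have h0 : 0 < t := one_pos.trans ht
    have hm0 := vasyuninE_nonneg hm h0
    have hn0 := vasyuninE_nonneg hn h0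
    rw [Real.norm_of_nonneg (mul_nonneg hm0 hn0)]
    calc _ ≤ 1 / t * (1 / t) :=
          mul_le_mul (vasyuninE_le_inv hm h0) (vasyuninE_le_inv hn h0) hn0 (by positivity)
      _ = 1 / t ^ 2 := by ring

/-! ### The constant as a regularised integral -/

/-- On (d, 1] the two integrands differ by 1/t² - 1/(2t), with primitive -1/t - (log t)/2. This
isolates the divergent terms as d → 0. -/
theorem integral_vasyuninFar_eq {d : ℝ} (hd : 0 < d) (hd1 : d ≤ 1) :
    ∫ t in Ioi d, vasyuninFar t =
      (∫ t in Ioi 1, vasyuninFar t) + (∫ t in Ioc d 1, vasyuninNear t)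
        + (1 / d - 1) + Real.log d / 2 := by
  have hfar := integrableOn_vasyuninFar hd
  rw [← Ioc_union_Ioi_eq_Ioi hd1, setIntegral_union (Ioc_disjoint_Ioi le_rfl) measurableSet_Ioi
    (hfar.mono_set Ioc_subset_Ioi_self) (hfar.mono_set (Ioi_subset_Ioi hd1))]
  have hnear := integrableOn_vasyuninNear hd.le 1
  have hsplit : ∫ t in Ioc d 1, vasyuninFar t - vasyuninNear t = (1 / d - 1) + Real.log d / 2 := by
    rw [← intervalIntegral.integral_of_le hd1]
    rw [intervalIntegral.integral_eq_sub_of_hasDerivAt (f := fun t => -1 / t - Real.log t / 2)]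
    · simp; ring
    · intro t ht
      rw [uIcc_of_le hd1] at ht
      have h0 : 0 < t := hd.trans_le ht.1
      have h := ((hasDerivAt_const t (-1 : ℝ)).div (hasDerivAt_id t) h0.ne').sub
        ((Real.hasDerivAt_log h0.ne').div_const 2)
      refine h.congr_deriv ?_
      rw [vasyuninFar_eq, vasyuninNear_eq_bose h0]
      simp only [id]
      field_simp
      ring
    · rw [intervalIntegrable_iff_integrableOn_Ioc_of_le hd1]
      exact (hfar.mono_set Ioc_subset_Ioi_self).sub hnear
  rw [integral_sub (hfar.mono_set Ioc_subset_Ioi_self) hnear] at hsplit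
  linarith

open Filter Topology in
/-- The constant `vasyuninC` as a regularised integral over `(0, ∞)`. -/
theorem tendsto_integral_vasyuninFar :
    Tendsto (fun d => (∫ t in Ioi d, vasyuninFar t) - 1 / d - Real.log d / 2)
      (𝓝[>] 0) (𝓝 (-vasyuninC)) := by
  have hnear : IntegrableOn ((Iic (1 : ℝ)).indicator vasyuninNear) (Ioi 0) := by
    rw [integrableOn_indicator_iff measurableSet_Iic, inter_comm, Ioi_inter_Iic]
    exact integrableOn_vasyuninNear le_rfl 1
  have h := (tendsto_integral_Ioi_nhdsGT_zero hnear).add_const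
    ((∫ t in Ioi 1, vasyuninFar t) - 1)
  simp_rw [setIntegral_indicator measurableSet_Iic, Ioi_inter_Iic] at h
  convert! h.congr' ?_ using 2
  · rw [vasyuninC]; ring
  · filter_upwards [Ioc_mem_nhdsGT one_pos] with d hd
    rw [integral_vasyuninFar_eq hd.1 hd.2]
    ring

/-! ### Primitives of the Bose–Einstein function and its behaviour at 0 -/

theorem hasDerivAt_bose {t : ℝ} (ht : 0 < t) :
    HasDerivAt bose (-(bose t ^ 2 + bose t)) t := by
  have h := (exp_sub_one_pos ht).ne'
  refine (((hasDerivAt_const t (1 : ℝ)).div ((Real.hasDerivAt_exp t).sub_const 1) h).congr_deriv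
    ?_)
  rw [bose]
  field_simp
  ring

open Filter Topology in
theorem tendsto_bose_atTop : Tendsto bose atTop (𝓝 0) := by
  unfold bose
  simp_rw [one_div]
  exact tendsto_inv_atTop_zero.comp (tendsto_atTop_add_const_right _ _ Real.tendsto_exp_atTop)

theorem integrableOn_bose_sq_add {d : ℝ} (hd : 0 < d) :
    IntegrableOn (fun t => bose t ^ 2 + bose t) (Ioi d) := by
  have := integrableOn_Ioi_deriv_of_nonpos' (a := d) (g := bose)
    (g' := fun t => -(bose t ^ 2 + bose t)) (fun t ht => hasDerivAt_bose (hd.trans_le ht))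
    (fun t ht => by
      have := bose_pos (hd.trans ht)
      have : 0 ≤ bose t ^ 2 + bose t := by positivity
      linarith) tendsto_bose_atTop
  exact integrable_neg_iff.1 this

theorem integral_bose_sq_add {d : ℝ} (hd : 0 < d) :
    ∫ t in Ioi d, (bose t ^ 2 + bose t) = bose d := by
  have := integral_Ioi_of_hasDerivAt_of_tendsto' (a := d) (f := bose)
    (f' := fun t => -(bose t ^ 2 + bose t)) (fun t ht => hasDerivAt_bose (hd.trans_le ht))
    (integrableOn_bose_sq_add hd).neg tendsto_bose_atTop
  rw [integral_neg] at this
  linarith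

theorem one_sub_exp_neg_pos {t : ℝ} (ht : 0 < t) : 0 < 1 - Real.exp (-t) := by
  have : Real.exp (-t) < 1 := by simpa using ht
  linarith

theorem hasDerivAt_log_one_sub_exp_neg {t : ℝ} (ht : 0 < t) :
    HasDerivAt (fun t => Real.log (1 - Real.exp (-t))) (bose t) t := by
  have h := (((hasDerivAt_neg t).exp).const_sub 1).log (one_sub_exp_neg_pos ht).ne'
  refine h.congr_deriv ?_
  rw [bose_eq_exp_neg ht]
  ring

open Filter Topology in
theorem tendsto_log_one_sub_exp_neg_atTop :
    Tendsto (fun t => Real.log (1 - Real.exp (-t))) atTop (𝓝 0) := by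
  have h : Tendsto (fun t : ℝ => 1 - Real.exp (-t)) atTop (𝓝 1) := by
    simpa using (Real.tendsto_exp_neg_atTop_nhds_zero).const_sub 1
  simpa using h.log one_ne_zero

theorem integrableOn_bose {d : ℝ} (hd : 0 < d) : IntegrableOn bose (Ioi d) :=
  integrableOn_Ioi_deriv_of_nonneg' (fun _ ht => hasDerivAt_log_one_sub_exp_neg (hd.trans_le ht))
    (fun _ ht => (bose_pos (hd.trans ht)).le) tendsto_log_one_sub_exp_neg_atTop

theorem integral_bose {d : ℝ} (hd : 0 < d) :
    ∫ t in Ioi d, bose t = -Real.log (1 - Real.exp (-d)) := by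
  rw [integral_Ioi_of_hasDerivAt_of_tendsto'
    (fun _ ht => hasDerivAt_log_one_sub_exp_neg (hd.trans_le ht)) (integrableOn_bose hd)
    tendsto_log_one_sub_exp_neg_atTop]
  ring

open Filter Topology in
theorem tendsto_one_sub_exp_neg_div :
    Tendsto (fun t : ℝ => (1 - Real.exp (-t)) / t) (𝓝[>] 0) (𝓝 1) := by
  have h : HasDerivAt (fun t : ℝ => 1 - Real.exp (-t)) 1 0 := by
    simpa using ((hasDerivAt_neg (0 : ℝ)).exp).const_sub 1
  have := (hasDerivAt_iff_tendsto_slope.1 h).mono_left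
    (nhdsWithin_mono 0 fun x (hx : 0 < x) => hx.ne')
  refine this.congr fun t => ?_
  simp [slope_def_field]

open Filter Topology in
theorem tendsto_log_one_sub_exp_neg_sub_log :
    Tendsto (fun t => Real.log (1 - Real.exp (-t)) - Real.log t) (𝓝[>] 0) (𝓝 0) := by
  have h := tendsto_one_sub_exp_neg_div.log one_ne_zero
  rw [Real.log_one] at h
  refine h.congr' ?_
  filter_upwards [self_mem_nhdsWithin] with t ht
  exact Real.log_div (one_sub_exp_neg_pos ht).ne' (ne_of_gt ht)

-- This limit is the source of the term -1/2 in the final formula.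
open Filter Topology in
theorem tendsto_bose_sub_inv : Tendsto (fun t => bose t - 1 / t) (𝓝[>] 0) (𝓝 (-1 / 2)) := by
  have h : Tendsto (fun t : ℝ => -1 / 2 + t / 4) (𝓝[>] 0) (𝓝 (-1 / 2)) := by
    have : Continuous fun t : ℝ => -1 / 2 + t / 4 := by fun_prop
    simpa using (this.tendsto 0).mono_left nhdsWithin_le_nhds
  refine tendsto_of_tendsto_of_tendsto_of_le_of_le' tendsto_const_nhds h ?_ ?_
  · filter_upwards [self_mem_nhdsWithin] with t ht
    linarith [inv_sub_bose_le_half ht]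
  · filter_upwards [self_mem_nhdsWithin] with t ht
    linarith [half_sub_le_inv_sub_bose ht]

/-! ### Popoviciu's formula -/

/-- For Bézout coefficients `m * u + n * v = 1`, the number of ways to write `N ≥ 0` as a
nonnegative combination of `m` and `n` (Popoviciu). -/
def popoviciu (m n u v N : ℤ) : ℤ := u * N / n + v * N / m + 1

/-- A shift by n moves the first quotient by exactly u, a shift by m moves the second by exactly v,
so the mixed second difference cancels. It corresponds to multiplying a power series by (1 - y^m)(1
- y^n). -/
theorem popoviciu_second_difference {m n : ℤ} (hm : m ≠ 0) (hn : n ≠ 0) (u v N : ℤ) :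
    popoviciu m n u v N - popoviciu m n u v (N - m) - popoviciu m n u v (N - n)
      + popoviciu m n u v (N - m - n) = 0 := by
  have h1 : u * (N - n) / n = u * N / n - u := by
    rw [show u * (N - n) = u * N + (-u) * n by ring, Int.add_mul_ediv_right _ _ hn]; ring
  have h2 : u * (N - m - n) / n = u * (N - m) / n - u := by
    rw [show u * (N - m - n) = u * (N - m) + (-u) * n by ring, Int.add_mul_ediv_right _ _ hn]
    ring
  have h3 : v * (N - m) / m = v * N / m - v := by
    rw [show v * (N - m) = v * N + (-v) * m by ring, Int.add_mul_ediv_right _ _ hm]; ring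
  have h4 : v * (N - m - n) / m = v * (N - n) / m - v := by
    rw [show v * (N - m - n) = v * (N - n) + (-v) * m by ring, Int.add_mul_ediv_right _ _ hm]
    ring
  unfold popoviciu
  rw [h1, h2, h3, h4]
  ring

theorem mul_popoviciu {m n u v : ℤ} (huv : m * u + n * v = 1) (N : ℤ) :
    m * n * popoviciu m n u v N
      = N - m * (u * N % n) - n * (v * N % m) + m * n := by
  have h1 := Int.mul_ediv_add_emod (u * N) n
  have h2 := Int.mul_ediv_add_emod (v * N) m
  unfold popoviciu
  linear_combination m * h1 + n * h2 + N * huv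

/-- By `mul_popoviciu` and the ranges of the two residues, mn times the value lies strictly between
-mn and mn, and the value is an integer. -/
theorem popoviciu_eq_zero {m n u v N : ℤ} (hm : 0 < m) (hn : 0 < n) (huv : m * u + n * v = 1)
    (hN : N < 0) (hN' : -(m + n) < N) : popoviciu m n u v N = 0 := by
  have h := mul_popoviciu huv N
  have h1 := Int.emod_nonneg (u * N) hn.ne'
  have h2 := Int.emod_nonneg (v * N) hm.ne'
  have h3 := Int.emod_lt_of_pos (u * N) hn
  have h4 := Int.emod_lt_of_pos (v * N) hm
  have hmn : 0 < m * n := mul_pos hm hn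
  have hlt : popoviciu m n u v N < 1 := by
    nlinarith [mul_nonneg hm.le h1, mul_nonneg hn.le h2]
  have hgt : -1 < popoviciu m n u v N := by
    have h5 : m * (u * N % n) ≤ m * (n - 1) := by gcongr; omega
    have h6 : n * (v * N % m) ≤ n * (m - 1) := by gcongr; omega
    nlinarith
  omega

theorem popoviciu_zero (m n u v : ℤ) : popoviciu m n u v 0 = 1 := by simp [popoviciu]

/-- The recurrence at N = 0 has both middle terms in the vanishing window. This is the one nonzero
boundary term in the generating function. -/
theorem popoviciu_neg_add {m n u v : ℤ} (hm : 0 < m) (hn : 0 < n) (huv : m * u + n * v = 1) :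
    popoviciu m n u v (-m - n) = -1 := by
  have h := popoviciu_second_difference hm.ne' hn.ne' u v 0
  rw [popoviciu_zero, zero_sub, zero_sub, popoviciu_eq_zero hm hn huv (by omega) (by omega),
    popoviciu_eq_zero hm hn huv (by omega) (by omega)] at h
  omega

/-! ### Generating functions and partial fractions -/

/-- The fractional part of `u * N / n`. -/
noncomputable def residueFract (n u N : ℤ) : ℝ := ((u * N % n : ℤ) : ℝ) / n

theorem residueFract_mem {n : ℤ} (hn : 0 < n) (u N : ℤ) : residueFract n u N ∈ Icc (0 : ℝ) 1 := by
  have hn' : (0 : ℝ) < n := by exact_mod_cast hn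
  have h1 : (0 : ℝ) ≤ ((u * N % n : ℤ) : ℝ) := by exact_mod_cast Int.emod_nonneg (u * N) hn.ne'
  have h2 : ((u * N % n : ℤ) : ℝ) ≤ n := by exact_mod_cast (Int.emod_lt_of_pos (u * N) hn).le
  exact ⟨div_nonneg h1 hn'.le, (div_le_one hn').2 h2⟩

theorem residueFract_add_self (n u N : ℤ) : residueFract n u (N + n) = residueFract n u N := by
  simp [residueFract, mul_add]

theorem residueFract_zero (n u : ℤ) : residueFract n u 0 = 0 := by simp [residueFract]

theorem residueFract_self_sub {n u N : ℤ} (hn : 0 < n) (h : ¬ n ∣ u * N) :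
    residueFract n u (n - N) = 1 - residueFract n u N := by
  have hn' : (n : ℝ) ≠ 0 := by exact_mod_cast hn.ne'
  have h0 : u * (n - N) % n = n - u * N % n := by
    have h1 : u * N % n ≠ 0 := fun h' => h (Int.dvd_of_emod_eq_zero h')
    have h2 := Int.emod_nonneg (u * N) hn.ne'
    have h3 := Int.emod_lt_of_pos (u * N) hn
    have h4 := Int.mul_ediv_add_emod (u * N) n
    rw [show u * (n - N) = (n - u * N % n) + n * (u - u * N / n - 1) by linear_combination h4,
      Int.add_mul_emod_self_left, Int.emod_eq_of_lt (by omega) (by omega)]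
  rw [residueFract, h0, residueFract]
  push_cast
  field_simp

theorem popoviciu_cast {m n u v : ℤ} (hm : 0 < m) (hn : 0 < n) (huv : m * u + n * v = 1) (N : ℤ) :
    (popoviciu m n u v N : ℝ)
      = N / (m * n) - residueFract n u N - residueFract m v N + 1 := by
  have hm' : (m : ℝ) ≠ 0 := by exact_mod_cast hm.ne'
  have hn' : (n : ℝ) ≠ 0 := by exact_mod_cast hn.ne'
  have h : (m : ℝ) * n * popoviciu m n u v N = N - m * ((u * N % n : ℤ) : ℝ)
      - n * ((v * N % m : ℤ) : ℝ) + m * n := by exact_mod_cast mul_popoviciu huv N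
  rw [residueFract, residueFract]
  field_simp
  linarith

/-- A periodic power series is a rational function. -/
theorem hasSum_periodic_mul_pow {g : ℕ → ℝ} {n : ℕ} (hg : ∀ N, g (N + n) = g N) {y : ℝ}
    (hn : n ≠ 0) (hy0 : 0 ≤ y) (hy1 : y < 1) (hs : Summable fun N => g N * y ^ N) :
    HasSum (fun N => g N * y ^ N) ((∑ r ∈ Finset.range n, g r * y ^ r) / (1 - y ^ n)) := by
  have hyn : y ^ n < 1 := pow_lt_one₀ hy0 hy1 hn
  have h := hs.sum_add_tsum_nat_add n
  have h' : ∑' N, g (N + n) * y ^ (N + n) = y ^ n * ∑' N, g N * y ^ N := by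
    rw [← tsum_mul_left]
    exact tsum_congr fun N => by rw [hg, pow_add]; ring
  rw [h'] at h
  convert hs.hasSum using 1
  rw [div_eq_iff (by linarith)]
  linarith

theorem summable_residueFract {n : ℤ} (hn : 0 < n) (u : ℤ) {y : ℝ} (hy0 : 0 ≤ y) (hy1 : y < 1) :
    Summable fun N : ℕ => residueFract n u N * y ^ N := by
  refine Summable.of_nonneg_of_le (fun N => ?_) (fun N => ?_)
    (summable_geometric_of_lt_one hy0 hy1)
  · exact mul_nonneg (residueFract_mem hn u N).1 (by positivity)
  · exact mul_le_of_le_one_left (by positivity) (residueFract_mem hn u N).2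

theorem hasSum_popoviciu {m n : ℕ} (hm : 1 ≤ m) (hn : 1 ≤ n) {u v : ℤ}
    (huv : (m : ℤ) * u + n * v = 1) {y : ℝ} (hy0 : 0 ≤ y) (hy1 : y < 1) :
    HasSum (fun N : ℕ => (popoviciu m n u v N : ℝ) * y ^ N)
      (1 / (m * n) * (y / (1 - y) ^ 2)
        - (∑ r ∈ Finset.range n, residueFract n u r * y ^ r) / (1 - y ^ n)
        - (∑ r ∈ Finset.range m, residueFract m v r * y ^ r) / (1 - y ^ m) + 1 / (1 - y)) := by
  have hm' : (0 : ℤ) < m := by omega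
  have hn' : (0 : ℤ) < n := by omega
  have h1 := (hasSum_coe_mul_geometric_of_norm_lt_one (r := y)
    (by rwa [Real.norm_of_nonneg hy0])).mul_left (1 / ((m : ℝ) * n))
  have h2 := hasSum_periodic_mul_pow (g := fun N => residueFract n u N)
    (fun N => by push_cast; exact residueFract_add_self n u N) (by omega) hy0 hy1
    (summable_residueFract hn' u hy0 hy1)
  have h3 := hasSum_periodic_mul_pow (g := fun N => residueFract m v N)
    (fun N => by push_cast; exact residueFract_add_self m v N) (by omega) hy0 hy1
    (summable_residueFract hm' v hy0 hy1)
  have h4 := hasSum_geometric_of_lt_one hy0 hy1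
  rw [← one_div] at h4
  refine (((h1.sub h2).sub h3).add h4).congr_fun fun N => ?_
  rw [popoviciu_cast hm' hn' huv]
  push_cast
  ring

/-- The coefficients are kept at negative indices, so the recurrence holds at every N and the summed
second difference is 0. The shifted series then contribute boundary terms, all zero except the
coefficient -1 at index -(m + n), and that one supplies the numerator. -/
theorem one_div_mul_eq_tsum_popoviciu {m n : ℕ} (hm : 1 ≤ m) (hn : 1 ≤ n) {u v : ℤ}
    (huv : (m : ℤ) * u + n * v = 1) {y : ℝ} (hy0 : 0 ≤ y) (hy1 : y < 1) :
    1 / ((1 - y ^ m) * (1 - y ^ n)) = ∑' N : ℕ, (popoviciu m n u v N : ℝ) * y ^ N := by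
  have hm' : (0 : ℤ) < m := by omega
  have hn' : (0 : ℤ) < n := by omega
  set c : ℤ → ℝ := fun N => (popoviciu m n u v N : ℝ) with hc
  have hs : Summable fun N : ℕ => c N * y ^ N := (hasSum_popoviciu hm hn huv hy0 hy1).summable
  have hshift : ∀ k : ℕ, (Summable fun N : ℕ => c (N - k) * y ^ N) ∧
      ∑' N : ℕ, c (N - k) * y ^ N
        = ∑ N ∈ Finset.range k, c (N - k) * y ^ N + y ^ k * ∑' N : ℕ, c N * y ^ N := by
    intro k
    have hs' : Summable fun N : ℕ => c (((N + k : ℕ) : ℤ) - k) * y ^ (N + k) := by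
      refine (hs.mul_left (y ^ k)).congr fun N => ?_
      push_cast
      rw [add_sub_cancel_right, pow_add]
      ring
    have hsk := (summable_nat_add_iff (f := fun N : ℕ => c ((N : ℤ) - k) * y ^ N) k).1 hs'
    refine ⟨hsk, ?_⟩
    rw [← hsk.sum_add_tsum_nat_add k, ← tsum_mul_left]
    congr 1
    refine tsum_congr fun N => ?_
    push_cast
    rw [add_sub_cancel_right, pow_add]
    ring
  have hzero : ∀ N : ℤ, N < 0 → -((m : ℤ) + n) < N → c N = 0 := fun N h h' => by
    simp only [hc, popoviciu_eq_zero hm' hn' huv h h', Int.cast_zero]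
  have hsum : ∀ k : ℕ, k < m + n → ∑ N ∈ Finset.range k, c (N - k) * y ^ N = 0 := by
    intro k hk
    refine Finset.sum_eq_zero fun N hN => ?_
    rw [Finset.mem_range] at hN
    rw [hzero _ (by omega) (by omega), zero_mul]
  have hsum' : ∑ N ∈ Finset.range (m + n), c (N - (m + n : ℕ)) * y ^ N = -1 := by
    rw [Finset.sum_eq_single 0]
    · have h := popoviciu_neg_add hm' hn' huv
      simp only [hc]
      push_cast
      rw [show (0 : ℤ) - (m + n) = -m - n by ring, h]
      simp
    · intro N hN hN0
      rw [Finset.mem_range] at hN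
      rw [hzero _ (by omega) (by omega), zero_mul]
    · intro h
      simp at h
      omega
  obtain ⟨sm, tm⟩ := hshift m
  obtain ⟨sn, tn⟩ := hshift n
  obtain ⟨smn, tmn⟩ := hshift (m + n)
  rw [hsum _ (by omega), zero_add] at tm tn
  rw [hsum', pow_add] at tmn
  have hdiff : ∑' N : ℕ, (c N * y ^ N - c (N - m) * y ^ N - c (N - n) * y ^ N
      + c (N - (m + n : ℕ)) * y ^ N) = 0 := by
    refine (tsum_congr fun N => ?_).trans tsum_zero
    have h := popoviciu_second_difference hm'.ne' hn'.ne' u v N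
    have h' : c N - c (N - m) - c (N - n) + c (N - m - n) = 0 := by
      simp only [hc]; exact_mod_cast h
    push_cast
    rw [← sub_sub (N : ℤ)]
    linear_combination y ^ N * h'
  rw [((hs.sub sm).sub sn).tsum_add smn, (hs.sub sm).tsum_sub sn, hs.tsum_sub sm, tm, tn,
    tmn] at hdiff
  have hym : y ^ m < 1 := pow_lt_one₀ hy0 hy1 (by omega)
  have hyn : y ^ n < 1 := pow_lt_one₀ hy0 hy1 (by omega)
  rw [div_eq_iff (mul_ne_zero (by linarith) (by linarith))]
  linarith

/-- The odd part of the partial fraction decomposition attached to the residues of `u * r`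
modulo `n`. -/
noncomputable def residueSum (n : ℕ) (u : ℤ) (y : ℝ) : ℝ :=
  ∑ r ∈ Finset.Icc 1 (n - 1), residueFract n u r * ((y ^ r - y ^ (n - r)) / (1 - y ^ n))

/-- The sum is averaged with its image under r ↦ n - r. Coprimality keeps ur/n non-integral for 0 <
r < n, so the fractional part becomes one minus itself; the ones add up to a geometric sum and the
rest is odd. -/
theorem sum_residueFract_eq {n : ℕ} (hn : 1 ≤ n) {u : ℤ} (hu : IsCoprime u n) {y : ℝ}
    (hy0 : 0 ≤ y) (hy1 : y < 1) :
    (∑ r ∈ Finset.range n, residueFract n u r * y ^ r) / (1 - y ^ n)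
      = 1 / 2 * residueSum n u y + 1 / 2 * (1 / (1 - y) - 1 / (1 - y ^ n)) := by
  have hyn : 1 - y ^ n ≠ 0 := by linarith [pow_lt_one₀ hy0 hy1 (show n ≠ 0 by omega)]
  have hI : Finset.Icc 1 (n - 1) = Finset.Ico 1 n := by ext; simp; omega
  have hrefl : ∀ f : ℕ → ℝ, ∑ r ∈ Finset.Ico 1 n, f (n - r) = ∑ r ∈ Finset.Ico 1 n, f r := by
    intro f
    refine Finset.sum_nbij' (fun r => n - r) (fun r => n - r) ?_ ?_ ?_ ?_ ?_ <;>
      simp only [Finset.mem_Ico] <;> intros <;> first | omega | trivial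
  have h0 : ∑ r ∈ Finset.range n, residueFract n u r * y ^ r
      = ∑ r ∈ Finset.Ico 1 n, residueFract n u r * y ^ r := by
    rw [Finset.range_eq_Ico, Finset.sum_eq_sum_Ico_succ_bot (by omega)]
    simp [residueFract_zero]
  have h1 : ∑ r ∈ Finset.Ico 1 n, residueFract n u r * y ^ r
      = ∑ r ∈ Finset.Ico 1 n, (1 - residueFract n u r) * y ^ (n - r) := by
    rw [← hrefl]
    refine Finset.sum_congr rfl fun r hr => ?_
    rw [Finset.mem_Ico] at hr
    rw [Nat.cast_sub hr.2.le, residueFract_self_sub (by omega)]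
    intro hdvd
    have := Int.le_of_dvd (by omega) (hu.symm.dvd_of_dvd_mul_left hdvd)
    omega
  have h2 : ∑ r ∈ Finset.Ico 1 n, y ^ (n - r) = (1 - y ^ n) / (1 - y) - 1 := by
    rw [hrefl fun r => y ^ r]
    have := geom_sum_eq hy1.ne n
    rw [Finset.range_eq_Ico, Finset.sum_eq_sum_Ico_succ_bot (by omega), pow_zero, zero_add] at this
    rw [← neg_sub (y ^ n), ← neg_sub y, neg_div_neg_eq]
    linarith
  have h3 : residueSum n u y * (1 - y ^ n) = ∑ r ∈ Finset.Ico 1 n, residueFract n u r * y ^ r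
      - ∑ r ∈ Finset.Ico 1 n, residueFract n u r * y ^ (n - r) := by
    rw [residueSum, Finset.sum_mul, hI, ← Finset.sum_sub_distrib]
    refine Finset.sum_congr rfl fun r _ => ?_
    field_simp
  simp_rw [sub_mul, one_mul, Finset.sum_sub_distrib] at h1
  rw [h2] at h1
  rw [h0, div_eq_iff hyn]
  have h4 : (1 / 2 * residueSum n u y + 1 / 2 * (1 / (1 - y) - 1 / (1 - y ^ n))) * (1 - y ^ n)
      = 1 / 2 * (residueSum n u y * (1 - y ^ n)) + 1 / 2 * ((1 - y ^ n) / (1 - y) - 1) := by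
    field_simp
  rw [h4, h3]
  linarith

theorem bose_natCast_mul {n : ℕ} (hn : 1 ≤ n) {t : ℝ} (ht : 0 < t) :
    bose (n * t) = 1 / (1 - Real.exp (-t) ^ n) - 1 := by
  have hn' : (0 : ℝ) < n := by exact_mod_cast hn
  have h := one_sub_exp_neg_pos (mul_pos hn' ht)
  rw [bose_eq_exp_neg (mul_pos hn' ht), ← Real.exp_nat_mul, mul_neg]
  field_simp
  ring

/-- Partial fraction decomposition of a product of two Bose–Einstein functions. -/
theorem bose_mul_bose {m n : ℕ} (hm : 1 ≤ m) (hn : 1 ≤ n) {u v : ℤ}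
    (huv : (m : ℤ) * u + n * v = 1) {t : ℝ} (ht : 0 < t) :
    bose (m * t) * bose (n * t) = 1 / (m * n) * (bose t ^ 2 + bose t)
      - 1 / 2 * (bose (m * t) + bose (n * t))
      - 1 / 2 * residueSum n u (Real.exp (-t)) - 1 / 2 * residueSum m v (Real.exp (-t)) := by
  have hy0 : 0 ≤ Real.exp (-t) := (Real.exp_pos _).le
  have hy1 : Real.exp (-t) < 1 := by linarith [one_sub_exp_neg_pos ht]
  have h := (one_div_mul_eq_tsum_popoviciu hm hn huv hy0 hy1).trans
    (hasSum_popoviciu hm hn huv hy0 hy1).tsum_eq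
  rw [sum_residueFract_eq hn ⟨m, v, by linarith⟩ hy0 hy1,
    sum_residueFract_eq hm ⟨n, u, by linarith⟩ hy0 hy1] at h
  have h1 : bose t = 1 / (1 - Real.exp (-t)) - 1 := by simpa using bose_natCast_mul le_rfl ht
  have h2 : bose t ^ 2 + bose t = Real.exp (-t) / (1 - Real.exp (-t)) ^ 2 := by
    have := (one_sub_exp_neg_pos ht).ne'
    rw [h1]
    field_simp
    ring
  rw [h2, bose_natCast_mul hm ht, bose_natCast_mul hn ht]
  rw [← one_div_mul_one_div] at h
  linear_combination h

/-! ### Cotangent integrals -/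

-- This is the Mittag-Leffler expansion of π cot(πx) regrouped: the partial sums of the two
-- arrangements differ by 1/x - 1/(x + K).
open Filter Topology in
theorem tendsto_sum_inv_sub_inv_cot {x : ℝ} (hx0 : 0 < x) (hx1 : x < 1) :
    Tendsto (fun K : ℕ => ∑ k ∈ Finset.range K, (1 / (x + k) - 1 / (1 - x + k))) atTop
      (𝓝 (Real.pi * Real.cot (Real.pi * x))) := by
  have hxZ : (x : ℂ) ∈ Complex.integerComplement := by
    rw [Complex.mem_integerComplement_iff]
    rintro ⟨k, hk⟩
    have hk' : (k : ℝ) = x := by exact_mod_cast hk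
    have h0 : (0 : ℤ) < k := by exact_mod_cast hk'.symm ▸ hx0
    have h1 : k < (1 : ℤ) := by exact_mod_cast hk'.symm ▸ hx1
    omega
  have h := (Complex.continuous_re.tendsto _).comp (tendsto_logDeriv_euler_cot_sub hxZ)
  have hlim : (Real.pi * Complex.cot (Real.pi * x) - 1 / (x : ℂ)).re
      = Real.pi * Real.cot (Real.pi * x) - 1 / x := by
    rw [← Complex.ofReal_re (Real.pi * Real.cot (Real.pi * x) - 1 / x)]
    push_cast
    rfl
  have hterm : ∀ K : ℕ, (∑ j ∈ Finset.range K, cotTerm (x : ℂ) j).re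
      = ∑ j ∈ Finset.range K, (1 / (x - (j + 1)) + 1 / (x + (j + 1))) := by
    intro K
    rw [Complex.re_sum]
    refine Finset.sum_congr rfl fun j _ => ?_
    rw [← Complex.ofReal_re (1 / (x - (j + 1)) + 1 / (x + (j + 1)))]
    push_cast
    rfl
  have hpart : ∀ K : ℕ, ∑ k ∈ Finset.range K, (1 / (x + k) - 1 / (1 - x + k))
      = ∑ j ∈ Finset.range K, (1 / (x - (j + 1)) + 1 / (x + (j + 1))) + 1 / x - 1 / (x + K) := by
    intro K
    induction K with
    | zero => simp
    | succ K ih =>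
      rw [Finset.sum_range_succ, Finset.sum_range_succ, ih]
      have : 1 / (x - (K + 1)) = - (1 / (1 - x + K)) := by
        rw [← one_div_neg_eq_neg_one_div]; ring_nf
      rw [this]
      push_cast
      ring
  have h0 : Tendsto (fun K : ℕ => 1 / (x + K)) atTop (𝓝 0) := by
    simp_rw [one_div]
    exact tendsto_inv_atTop_zero.comp
      (tendsto_atTop_add_const_left _ _ tendsto_natCast_atTop_atTop)
  simp_rw [hpart]
  have := ((h.congr hterm).add_const (1 / x)).sub h0
  rw [hlim] at this
  simpa using this

theorem hasSum_exp_sub_exp_div {a b c t : ℝ} (hc : 0 < c) (ht : 0 < t) :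
    HasSum (fun k : ℕ => Real.exp (-(a + k * c) * t) - Real.exp (-(b + k * c) * t))
      ((Real.exp (-a * t) - Real.exp (-b * t)) / (1 - Real.exp (-c * t))) := by
  have h1 : Real.exp (-c * t) < 1 := by
    rw [Real.exp_lt_one_iff]; nlinarith
  have h := (hasSum_geometric_of_lt_one (Real.exp_pos _).le h1).mul_left
    (Real.exp (-a * t) - Real.exp (-b * t))
  rw [← div_eq_mul_inv] at h
  refine h.congr_fun fun k => ?_
  rw [sub_mul, ← Real.exp_nat_mul, ← Real.exp_add, ← Real.exp_add]
  ring_nf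

theorem integrableOn_exp_neg_mul {a : ℝ} (ha : 0 < a) :
    IntegrableOn (fun t => Real.exp (-a * t)) (Ioi 0) :=
  integrableOn_exp_mul_Ioi (by linarith) 0

theorem integral_exp_neg_mul {a : ℝ} (ha : 0 < a) :
    ∫ t in Ioi 0, Real.exp (-a * t) = 1 / a := by
  rw [integral_exp_mul_Ioi (by linarith)]
  simp

theorem integral_exp_sub_exp {a b : ℝ} (ha : 0 < a) (hb : 0 < b) :
    ∫ t in Ioi 0, (Real.exp (-a * t) - Real.exp (-b * t)) = 1 / a - 1 / b := by
  rw [integral_sub (integrableOn_exp_neg_mul ha) (integrableOn_exp_neg_mul hb),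
    integral_exp_neg_mul ha, integral_exp_neg_mul hb]

/-- For a ≤ b the quotient is dominated by e^{-at}, since b ≤ a + c; the other case is its negative.
-/
theorem integrableOn_exp_sub_exp_div {a b c : ℝ} (ha : 0 < a) (hb : 0 < b) (hc : a + b = c) :
    IntegrableOn (fun t => (Real.exp (-a * t) - Real.exp (-b * t)) / (1 - Real.exp (-c * t)))
      (Ioi 0) := by
  wlog hab : a ≤ b generalizing a b
  · have := (this hb ha (by linarith) (by linarith)).neg
    refine this.congr_fun (fun t _ => ?_) measurableSet_Ioi
    simp only [Pi.neg_apply]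
    ring
  have hmeas : Measurable fun t =>
    (Real.exp (-a * t) - Real.exp (-b * t)) / (1 - Real.exp (-c * t)) := by fun_prop
  refine (integrableOn_exp_neg_mul ha).mono' hmeas.aestronglyMeasurable ?_
  filter_upwards [ae_restrict_mem measurableSet_Ioi] with t ht
  have ht : 0 < t := ht
  have h1 : Real.exp (-c * t) < 1 := by
    rw [Real.exp_lt_one_iff]; nlinarith
  have h2 : Real.exp (-b * t) ≤ Real.exp (-a * t) := Real.exp_le_exp.2 (by nlinarith)
  rw [Real.norm_of_nonneg (div_nonneg (by linarith) (by linarith)), div_le_iff₀ (by linarith)]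
  rw [mul_sub, mul_one, ← Real.exp_add]
  have : Real.exp (-a * t + -c * t) ≤ Real.exp (-b * t) := by
    refine Real.exp_le_exp.2 ?_
    nlinarith
  linarith

/-- The integral form of the reflection formula for the digamma function. -/
theorem integral_exp_sub_exp_div {a b c : ℝ} (ha : 0 < a) (hb : 0 < b) (hc : a + b = c) :
    ∫ t in Ioi 0, (Real.exp (-a * t) - Real.exp (-b * t)) / (1 - Real.exp (-c * t))
      = Real.pi / c * Real.cot (Real.pi * (a / c)) := by
  wlog hab : a ≤ b generalizing a b
  · have h := this hb ha (by linarith) (by linarith)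
    have hc0 : c ≠ 0 := by linarith
    have hcot : Real.cot (Real.pi * (b / c)) = -Real.cot (Real.pi * (a / c)) := by
      rw [show Real.pi * (b / c) = Real.pi - Real.pi * (a / c) by
        field_simp; linarith, Real.cot_eq_cos_div_sin, Real.cot_eq_cos_div_sin,
        Real.cos_pi_sub, Real.sin_pi_sub, neg_div]
    rw [hcot, mul_neg, ← neg_eq_iff_eq_neg, ← integral_neg] at h
    rw [← h]
    congr 1
    ext t
    ring
  have hc0 : 0 < c := by linarith
  have hak : ∀ k : ℕ, 0 < a + k * c := fun k => by positivity
  have hbk : ∀ k : ℕ, 0 < b + k * c := fun k => by positivity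
  have hlim : Filter.Tendsto (fun K : ℕ => ∑ k ∈ Finset.range K,
      (1 / (a + k * c) - 1 / (b + k * c))) Filter.atTop
      (nhds (Real.pi / c * Real.cot (Real.pi * (a / c)))) := by
    have h := (tendsto_sum_inv_sub_inv_cot (x := a / c) (by positivity)
      ((div_lt_one hc0).2 (by linarith))).const_mul (1 / c)
    rw [show Real.pi / c * Real.cot (Real.pi * (a / c))
      = 1 / c * (Real.pi * Real.cot (Real.pi * (a / c))) by ring]
    refine h.congr fun K => ?_
    rw [Finset.mul_sum]
    refine Finset.sum_congr rfl fun k _ => ?_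
    have e1 : a / c + k = (a + k * c) / c := by field_simp
    have e2 : 1 - a / c + k = (b + k * c) / c := by field_simp; linarith
    have := (hak k).ne'
    have := (hbk k).ne'
    rw [e1, e2]
    field_simp
  -- The reduction to a ≤ b pays off here: with nonnegative terms, convergence of partial sums is
  -- summability, which permits termwise integration.
  have hnn : ∀ k : ℕ, 0 ≤ 1 / (a + k * c) - 1 / (b + k * c) := fun k =>
    sub_nonneg.2 (one_div_le_one_div_of_le (hak k) (by linarith))
  have hsum := (hasSum_iff_tendsto_nat_of_nonneg hnn _).2 hlim
  have hnorm : ∀ k : ℕ, ∫ t in Ioi 0,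
      ‖Real.exp (-(a + k * c) * t) - Real.exp (-(b + k * c) * t)‖
        = 1 / (a + k * c) - 1 / (b + k * c) := by
    intro k
    rw [← integral_exp_sub_exp (hak k) (hbk k)]
    refine setIntegral_congr_fun measurableSet_Ioi fun t ht => ?_
    have ht : 0 < t := ht
    exact Real.norm_of_nonneg (sub_nonneg.2 (Real.exp_le_exp.2 (by nlinarith)))
  have h := hasSum_integral_of_summable_integral_norm (μ := volume.restrict (Ioi 0))
    (F := fun (k : ℕ) t => Real.exp (-(a + k * c) * t) - Real.exp (-(b + k * c) * t))
    (fun k => (integrableOn_exp_neg_mul (hak k)).sub (integrableOn_exp_neg_mul (hbk k)))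
    (by simp_rw [hnorm]; exact hsum.summable)
  simp_rw [fun k => integral_exp_sub_exp (hak k) (hbk k)] at h
  rw [← h.unique hsum]
  refine setIntegral_congr_fun measurableSet_Ioi fun t ht => ?_
  exact (hasSum_exp_sub_exp_div hc0 ht).tsum_eq.symm

theorem residueSum_term_eq (n r : ℕ) (t : ℝ) :
    (Real.exp (-t) ^ r - Real.exp (-t) ^ (n - r)) / (1 - Real.exp (-t) ^ n)
      = (Real.exp (-(r : ℝ) * t) - Real.exp (-((n - r : ℕ) : ℝ) * t))
        / (1 - Real.exp (-(n : ℝ) * t)) := by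
  simp only [← Real.exp_nat_mul, mul_neg, neg_mul]

theorem integrableOn_residueSum (n : ℕ) (u : ℤ) :
    IntegrableOn (fun t => residueSum n u (Real.exp (-t))) (Ioi 0) := by
  refine integrable_finsetSum _ fun r hr => Integrable.const_mul ?_ _
  rw [Finset.mem_Icc] at hr
  have hrn : r < n := by omega
  simp_rw [residueSum_term_eq]
  refine integrableOn_exp_sub_exp_div (by exact_mod_cast hr.1)
    (by exact_mod_cast (show 0 < n - r by omega)) ?_
  push_cast [hrn.le]
  ring

theorem integral_residueSum (n : ℕ) (u : ℤ) :
    ∫ t in Ioi 0, residueSum n u (Real.exp (-t))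
      = Real.pi / n * ∑ r ∈ Finset.Icc 1 (n - 1),
          residueFract n u r * Real.cot (Real.pi * (r / n)) := by
  have key : ∀ r ∈ Finset.Icc 1 (n - 1), IntegrableOn (fun t : ℝ =>
      (Real.exp (-t) ^ r - Real.exp (-t) ^ (n - r)) / (1 - Real.exp (-t) ^ n)) (Ioi 0) ∧
      ∫ t in Ioi 0, (Real.exp (-t) ^ r - Real.exp (-t) ^ (n - r)) / (1 - Real.exp (-t) ^ n)
        = Real.pi / n * Real.cot (Real.pi * (r / n)) := by
    intro r hr
    rw [Finset.mem_Icc] at hr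
    have hrn : r < n := by omega
    have h0 : (0 : ℝ) < r := by exact_mod_cast hr.1
    have h1 : (0 : ℝ) < (n - r : ℕ) := by exact_mod_cast (show 0 < n - r by omega)
    have h2 : (r : ℝ) + (n - r : ℕ) = n := by push_cast [hrn.le]; ring
    simp_rw [residueSum_term_eq]
    exact ⟨integrableOn_exp_sub_exp_div h0 h1 h2, integral_exp_sub_exp_div h0 h1 h2⟩
  unfold residueSum
  rw [integral_finsetSum _ fun r hr => (key r hr).1.const_mul _, Finset.mul_sum]
  refine Finset.sum_congr rfl fun r hr => ?_
  rw [integral_const_mul, (key r hr).2]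
  ring

theorem cot_add_int_mul_pi (x : ℝ) (k : ℤ) : Real.cot (x + k * Real.pi) = Real.cot x := by
  rw [Real.cot_eq_cos_div_sin, Real.cot_eq_cos_div_sin, Real.cos_add_int_mul_pi,
    Real.sin_add_int_mul_pi, mul_div_mul_left _ _ (zpow_ne_zero k (by norm_num))]

/-- Reindexing of the cotangent sum by multiplication by `m`, the inverse of `u` modulo `n`. -/
theorem sum_residueFract_mul_cot {m n : ℕ} {u v : ℤ}
    (huv : (m : ℤ) * u + n * v = 1) :
    ∑ r ∈ Finset.Icc 1 (n - 1), residueFract n u r * Real.cot (Real.pi * (r / n))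
      = ∑ k ∈ Finset.Icc 1 (n - 1),
          (k : ℝ) / n * Real.cot ((m : ℝ) * k * Real.pi / n) := by
  have hne : ∀ (a : ℤ) (b : ℤ), IsCoprime a (n : ℤ) → 1 ≤ b → b < n →
      1 ≤ a * b % n ∧ a * b % n < n := by
    intro a b hab h1 h2
    have h3 := Int.emod_nonneg (a * b) (show (n : ℤ) ≠ 0 by omega)
    have h4 := Int.emod_lt_of_pos (a * b) (show (0 : ℤ) < n by omega)
    have h5 : a * b % n ≠ 0 := fun h => by
      have := Int.le_of_dvd (by omega) (hab.symm.dvd_of_dvd_mul_left (Int.dvd_of_emod_eq_zero h))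
      omega
    omega
  have hu : IsCoprime u (n : ℤ) := ⟨m, v, by linarith⟩
  have hm : IsCoprime (m : ℤ) (n : ℤ) := ⟨u, v, by linarith⟩
  have hinv : ∀ (a b c : ℤ), a * b + n * v = 1 → 1 ≤ c → c < n →
      a * (b * c % n) % n = c := by
    intro a b c hab h1 h2
    rw [Int.mul_emod, Int.emod_emod_of_dvd _ dvd_rfl, ← Int.mul_emod,
      show a * (b * c) = c + n * (-v * c) by linear_combination c * hab,
      Int.add_mul_emod_self_left, Int.emod_eq_of_lt (by omega) h2]
  refine Finset.sum_nbij' (fun r => (u * r % n).toNat) (fun k => ((m : ℤ) * k % n).toNat)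
    ?_ ?_ ?_ ?_ ?_
  · intro r hr
    simp only [Finset.mem_Icc] at hr ⊢
    have := hne u r hu (by omega) (by omega)
    omega
  · intro r hr
    simp only [Finset.mem_Icc] at hr ⊢
    have := hne m r hm (by omega) (by omega)
    omega
  · intro r hr
    simp only [Finset.mem_Icc] at hr
    have := hne u r hu (by omega) (by omega)
    have h := hinv m u r huv (by omega) (by omega)
    rw [Int.toNat_of_nonneg (by omega), h, Int.toNat_natCast]
  · intro r hr
    simp only [Finset.mem_Icc] at hr
    have := hne m r hm (by omega) (by omega)
    have h := hinv u m r (by linarith) (by omega) (by omega)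
    rw [Int.toNat_of_nonneg (by omega), h, Int.toNat_natCast]
  · intro r hr
    simp only [Finset.mem_Icc] at hr
    have h1 := hne u r hu (by omega) (by omega)
    have h2 : (((u * r % n).toNat : ℕ) : ℝ) = ((u * r % n : ℤ) : ℝ) := by
      exact_mod_cast congrArg (Int.cast : ℤ → ℝ) (Int.toNat_of_nonneg (by omega))
    have hn : (n : ℝ) ≠ 0 := by
      have : n ≠ 0 := by omega
      exact_mod_cast this
    -- Since mu ≡ 1 modulo n, the two cotangent arguments differ by an integer multiple of π.
    have h3 : (m : ℤ) * (u * r % n) = r + (-v * r - m * (u * r / n)) * n := by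
      have := Int.mul_ediv_add_emod (u * r) n
      linear_combination m * this + r * huv
    have h4 : (m : ℝ) * ((u * r % n : ℤ) : ℝ)
        = r + ((-v * r - m * (u * r / n) : ℤ) : ℝ) * n := by exact_mod_cast h3
    rw [h2, h4, residueFract, ← cot_add_int_mul_pi _ (-v * r - m * (u * r / n))]
    congr 2
    push_cast
    field_simp

/-! ### Euler's constant and the exponential integral -/

/-- Both sides are Γ'(1), the left one by differentiating Euler's integral under the integral sign.
-/
theorem integral_log_mul_exp_neg :
    ∫ t in Ioi 0, Real.log t * Real.exp (-t) = -Real.eulerMascheroniConstant := by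
  have h1 := Complex.hasDerivAt_GammaIntegral (s := 1) (by simp)
  have h2 : HasDerivAt Complex.GammaIntegral (-Real.eulerMascheroniConstant : ℂ) 1 := by
    refine Complex.hasDerivAt_Gamma_one.congr_of_eventuallyEq ?_
    have : {s : ℂ | 0 < s.re} ∈ nhds (1 : ℂ) :=
      (isOpen_lt continuous_const Complex.continuous_re).mem_nhds (by simp)
    filter_upwards [this] with s hs using (Complex.Gamma_eq_integral hs).symm
  have h := h1.unique h2
  simp only [sub_self, Complex.cpow_zero, one_mul] at h
  have h' : ∫ t in Ioi (0 : ℝ), (Real.log t : ℂ) * (Real.exp (-t) : ℂ)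
      = ((∫ t in Ioi 0, Real.log t * Real.exp (-t) : ℝ) : ℂ) := by
    rw [← integral_complex_ofReal]
    push_cast
    rfl
  rw [h'] at h
  exact_mod_cast h

/-- The Bochner integral of a non-integrable function is 0 by convention, whereas this one equals -γ
≠ 0. -/
theorem integrableOn_log_mul_exp_neg :
    IntegrableOn (fun t => Real.log t * Real.exp (-t)) (Ioi 0) := by
  by_contra h
  have := integral_log_mul_exp_neg
  rw [integral_undef h] at this
  linarith [Real.one_half_lt_eulerMascheroniConstant]

theorem integrableOn_exp_neg_div {d : ℝ} (hd : 0 < d) :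
    IntegrableOn (fun t => Real.exp (-t) / t) (Ioi d) := by
  have hmeas : Measurable fun t : ℝ => Real.exp (-t) / t := by fun_prop
  refine ((integrableOn_exp_neg_Ioi d).div_const d).mono' hmeas.aestronglyMeasurable ?_
  filter_upwards [ae_restrict_mem measurableSet_Ioi] with t ht
  have ht : d < t := ht
  have h0 : 0 < t := hd.trans ht
  rw [Real.norm_of_nonneg (by positivity)]
  gcongr

theorem integral_exp_neg_div {d : ℝ} (hd : 0 < d) :
    ∫ t in Ioi d, Real.exp (-t) / t
      = (∫ t in Ioi d, Real.log t * Real.exp (-t)) - Real.log d * Real.exp (-d) := by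
  have hlog := integrableOn_log_mul_exp_neg.mono_set (Ioi_subset_Ioi hd.le)
  have hlim : Filter.Tendsto (fun t => Real.log t * Real.exp (-t)) Filter.atTop (nhds 0) := by
    have h1 := Real.tendsto_pow_mul_exp_neg_atTop_nhds_zero 1
    refine squeeze_zero' ?_ ?_ h1
    · filter_upwards [Filter.eventually_ge_atTop 1] with t ht
      exact mul_nonneg (Real.log_nonneg ht) (Real.exp_pos _).le
    · filter_upwards [Filter.eventually_ge_atTop 1] with t ht
      rw [pow_one]
      exact mul_le_mul_of_nonneg_right (Real.log_le_self (by linarith)) (Real.exp_pos _).le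
  have h := integral_Ioi_of_hasDerivAt_of_tendsto' (a := d)
    (f := fun t => Real.log t * Real.exp (-t))
    (f' := fun t => Real.exp (-t) / t - Real.log t * Real.exp (-t))
    (fun t ht => by
      have h0 : 0 < t := hd.trans_le ht
      refine ((Real.hasDerivAt_log h0.ne').mul (hasDerivAt_neg t).exp).congr_deriv ?_
      field_simp
      ring)
    ((integrableOn_exp_neg_div hd).sub hlog) hlim
  rw [integral_sub (integrableOn_exp_neg_div hd) hlog] at h
  linarith

open Filter Topology in
/-- The logarithmic singularity of the exponential integral. -/
theorem tendsto_integral_exp_neg_div_add_log :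
    Tendsto (fun d => (∫ t in Ioi d, Real.exp (-t) / t) + Real.log d) (𝓝[>] 0)
      (𝓝 (-Real.eulerMascheroniConstant)) := by
  have h1 := tendsto_integral_Ioi_nhdsGT_zero integrableOn_log_mul_exp_neg
  have h2 : Tendsto (fun d => Real.log d * d) (𝓝[>] 0) (𝓝 0) := by
    simpa using tendsto_log_mul_rpow_nhdsGT_zero one_pos
  have h := h1.add (h2.mul tendsto_one_sub_exp_neg_div)
  rw [integral_log_mul_exp_neg, zero_mul, add_zero] at h
  refine h.congr' ?_
  filter_upwards [self_mem_nhdsWithin] with d hd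
  have hd : 0 < d := hd
  rw [integral_exp_neg_div hd]
  field_simp
  ring

/-! ### Binet's formula and the closed form of the constant -/

theorem integrableOn_vasyuninNear_mul_exp {j : ℝ} (hj : 0 < j) :
    IntegrableOn (fun t => vasyuninNear t * Real.exp (-j * t)) (Ioi 0) := by
  have hmeas : Measurable fun t => vasyuninNear t * Real.exp (-j * t) := by fun_prop
  refine ((integrableOn_exp_neg_mul hj).const_mul (1 / 4)).mono' hmeas.aestronglyMeasurable ?_
  filter_upwards [ae_restrict_mem measurableSet_Ioi] with t ht
  rw [Real.norm_of_nonneg (mul_nonneg (vasyuninNear_nonneg ht) (Real.exp_pos _).le)]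
  exact mul_le_mul_of_nonneg_right (vasyuninNear_le ht) (Real.exp_pos _).le

theorem integral_vasyuninNear_mul_exp_mem {j : ℝ} (hj : 0 < j) :
    ∫ t in Ioi 0, vasyuninNear t * Real.exp (-j * t) ∈ Icc 0 (1 / 4 * (1 / j)) := by
  constructor
  · exact setIntegral_nonneg measurableSet_Ioi fun t ht =>
      mul_nonneg (vasyuninNear_nonneg ht) (Real.exp_pos _).le
  · rw [← integral_exp_neg_mul hj, ← integral_const_mul]
    refine setIntegral_mono_on (integrableOn_vasyuninNear_mul_exp hj)
      ((integrableOn_exp_neg_mul hj).const_mul _) measurableSet_Ioi fun t ht => ?_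
    exact mul_le_mul_of_nonneg_right (vasyuninNear_le ht) (Real.exp_pos _).le

theorem integral_exp_neg_mul_div {j d : ℝ} (hj : 0 < j) :
    ∫ t in Ioi d, Real.exp (-j * t) / t = ∫ t in Ioi (j * d), Real.exp (-t) / t := by
  have h := integral_comp_mul_left_Ioi (fun t => Real.exp (-t) / t) d hj
  rw [smul_eq_mul, ← div_eq_inv_mul, eq_div_iff hj.ne', mul_comm, ← integral_const_mul] at h
  rw [← h]
  congr 1
  ext t
  rw [neg_mul]
  field_simp

theorem integrableOn_exp_neg_mul_div {j d : ℝ} (hj : 0 < j) (hd : 0 < d) :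
    IntegrableOn (fun t => Real.exp (-j * t) / t) (Ioi d) := by
  have h := (integrableOn_Ioi_comp_mul_left_iff (fun t => Real.exp (-t) / t) d hj).2
    (integrableOn_exp_neg_div (mul_pos hj hd))
  refine IntegrableOn.congr_fun (h.const_mul j) (fun t ht => ?_) measurableSet_Ioi
  have : 0 < t := hd.trans ht
  simp only [neg_mul]
  field_simp

open Filter Topology in
theorem tendsto_mul_left_nhdsGT_zero {a : ℝ} (ha : 0 < a) :
    Tendsto (fun d : ℝ => a * d) (𝓝[>] 0) (𝓝[>] 0) := by
  refine tendsto_nhdsWithin_iff.2 ⟨?_, ?_⟩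
  · have : Continuous fun d : ℝ => a * d := by fun_prop
    simpa using (this.tendsto 0).mono_left nhdsWithin_le_nhds
  · filter_upwards [self_mem_nhdsWithin] with d hd using mul_pos ha hd

open Filter Topology in
/-- One step of Binet's formula. -/
theorem integral_vasyuninNear_mul_exp_sub {j : ℝ} (hj : 0 < j) :
    (∫ t in Ioi 0, vasyuninNear t * Real.exp (-j * t))
      - ∫ t in Ioi 0, vasyuninNear t * Real.exp (-(j + 1) * t)
      = (j + 1 / 2) * (Real.log (j + 1) - Real.log j) - 1 := by
  have hj1 : 0 < j + 1 := by linarith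
  have hint : IntegrableOn (fun t => vasyuninNear t * Real.exp (-j * t)
      - vasyuninNear t * Real.exp (-(j + 1) * t)) (Ioi 0) :=
    (integrableOn_vasyuninNear_mul_exp hj).sub (integrableOn_vasyuninNear_mul_exp hj1)
  rw [← integral_sub (integrableOn_vasyuninNear_mul_exp hj)
    (integrableOn_vasyuninNear_mul_exp hj1)]
  refine tendsto_nhds_unique (tendsto_integral_Ioi_nhdsGT_zero hint) ?_
  -- The factor 1 - e^{-t} cancels the denominator of B, so the integrand is F' plus (j + 1/2) times
  -- a difference of exponential-integral integrands. The limit of F at 0 gives the -1, the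
  -- differing logarithmic singularities give log((j + 1)/j).
  set F : ℝ → ℝ := fun t => (1 - Real.exp (-t)) * Real.exp (-j * t) / t with hF
  have hlimtop : Tendsto F atTop (𝓝 0) := by
    have h1 : Tendsto (fun t : ℝ => 1 / t) atTop (𝓝 0) := by
      simpa using tendsto_inv_atTop_zero (𝕜 := ℝ)
    refine squeeze_zero' ?_ ?_ h1
    · filter_upwards [eventually_gt_atTop 0] with t ht
      have := one_sub_exp_neg_pos ht
      positivity
    · filter_upwards [eventually_gt_atTop 0] with t ht
      have h2 := one_sub_exp_neg_pos ht
      have h3 : Real.exp (-j * t) ≤ 1 := Real.exp_le_one_iff.2 (by nlinarith)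
      have h4 : 1 - Real.exp (-t) ≤ 1 := by linarith [Real.exp_pos (-t)]
      simp only [hF]
      gcongr
      exact mul_le_one₀ h4 (Real.exp_pos _).le h3
  have hlim0 : Tendsto F (𝓝[>] 0) (𝓝 1) := by
    have h1 : Tendsto (fun t : ℝ => Real.exp (-j * t)) (𝓝[>] 0) (𝓝 1) := by
      have : Continuous fun t : ℝ => Real.exp (-j * t) := by fun_prop
      simpa using (this.tendsto 0).mono_left nhdsWithin_le_nhds
    have h2 := tendsto_one_sub_exp_neg_div.mul h1
    rw [mul_one] at h2
    exact h2.congr fun t => by simp only [hF]; ring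
  have hval : ∀ d : ℝ, 0 < d →
      ∫ t in Ioi d, (vasyuninNear t * Real.exp (-j * t) - vasyuninNear t * Real.exp (-(j + 1) * t))
        = -F d + (j + 1 / 2) * ((∫ t in Ioi (j * d), Real.exp (-t) / t)
          - ∫ t in Ioi ((j + 1) * d), Real.exp (-t) / t) := by
    intro d hd
    have hE : IntegrableOn (fun t => Real.exp (-j * t) / t - Real.exp (-(j + 1) * t) / t)
        (Ioi d) :=
      (integrableOn_exp_neg_mul_div hj hd).sub (integrableOn_exp_neg_mul_div hj1 hd)
    have hid : ∀ t : ℝ, 0 < t → HasDerivAt F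
        ((vasyuninNear t * Real.exp (-j * t) - vasyuninNear t * Real.exp (-(j + 1) * t))
          - (j + 1 / 2) * (Real.exp (-j * t) / t - Real.exp (-(j + 1) * t) / t)) t := by
      intro t ht
      have h1 : HasDerivAt (fun t : ℝ => Real.exp (-j * t)) (Real.exp (-j * t) * -j) t := by
        simpa using ((hasDerivAt_id t).const_mul (-j)).exp
      have h := ((((hasDerivAt_neg t).exp).const_sub 1).mul h1).div (hasDerivAt_id t) ht.ne'
      refine h.congr_deriv ?_
      have hL : bose t * (1 - Real.exp (-t)) = Real.exp (-t) := by
        rw [bose_eq_exp_neg ht, div_mul_cancel₀ _ (one_sub_exp_neg_pos ht).ne']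
      have hexp : Real.exp (-(j + 1) * t) = Real.exp (-j * t) * Real.exp (-t) := by
        rw [← Real.exp_add]; ring_nf
      rw [vasyuninNear_eq_bose ht, hexp]
      simp only [id, Pi.mul_apply]
      field_simp
      linear_combination (-2 * t) * hL
    have h := integral_Ioi_of_hasDerivAt_of_tendsto' (fun t ht => hid t (hd.trans_le ht))
      ((hint.mono_set (Ioi_subset_Ioi hd.le)).sub (hE.const_mul (j + 1 / 2))) hlimtop
    rw [integral_sub (hint.mono_set (Ioi_subset_Ioi hd.le)) (hE.const_mul (j + 1 / 2)),
      integral_const_mul, integral_sub (integrableOn_exp_neg_mul_div hj hd)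
      (integrableOn_exp_neg_mul_div hj1 hd), integral_exp_neg_mul_div hj,
      integral_exp_neg_mul_div hj1] at h
    linarith
  have hW := tendsto_integral_exp_neg_div_add_log
  have h := hlim0.neg.add (((hW.comp (tendsto_mul_left_nhdsGT_zero hj)).sub
    (hW.comp (tendsto_mul_left_nhdsGT_zero hj1))).const_mul (j + 1 / 2)) |>.add_const
      ((j + 1 / 2) * (Real.log (j + 1) - Real.log j))
  convert! h.congr' ?_ using 2
  · ring
  · filter_upwards [self_mem_nhdsWithin] with d hd
    have hd : 0 < d := hd
    simp only [Function.comp_apply]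
    rw [hval d hd, Real.log_mul hj.ne' hd.ne', Real.log_mul hj1.ne' hd.ne']
    ring

/-- The increment equals that of the Binet integral at j = N, so the two sequences differ by a
constant. -/
theorem log_stirlingSeq_sub {N : ℕ} (hN : 1 ≤ N) :
    Real.log (Stirling.stirlingSeq N) - Real.log (Stirling.stirlingSeq (N + 1))
      = ((N : ℝ) + 1 / 2) * (Real.log (N + 1) - Real.log N) - 1 := by
  have h0 : (N : ℝ) ≠ 0 := by exact_mod_cast (show N ≠ 0 by omega)
  have h1 : (N : ℝ) + 1 ≠ 0 := by positivity
  have hf : ((N.factorial : ℕ) : ℝ) ≠ 0 := by exact_mod_cast N.factorial_ne_zero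
  rw [Stirling.log_stirlingSeq_formula, Stirling.log_stirlingSeq_formula, Nat.factorial_succ]
  push_cast
  rw [Real.log_mul h1 hf, Real.log_mul two_ne_zero h0, Real.log_mul two_ne_zero h1,
    Real.log_div h0 (Real.exp_pos 1).ne', Real.log_div h1 (Real.exp_pos 1).ne', Real.log_exp]
  ring

/-- Binet's formula at `1`. -/
theorem integral_vasyuninNear_mul_exp_one :
    ∫ t in Ioi 0, vasyuninNear t * Real.exp (-t) = 1 - Real.log (2 * Real.pi) / 2 := by
  set φ : ℝ → ℝ := fun j => ∫ t in Ioi 0, vasyuninNear t * Real.exp (-j * t) with hφ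
  have hstep : ∀ N : ℕ, φ (N + 1 : ℕ) - Real.log (Stirling.stirlingSeq (N + 1))
      = φ 1 - Real.log (Stirling.stirlingSeq 1) := by
    intro N
    induction N with
    | zero => simp
    | succ N ih =>
      rw [← ih]
      have h1 := integral_vasyuninNear_mul_exp_sub (j := (N + 1 : ℕ)) (by positivity)
      have h2 := log_stirlingSeq_sub (N := N + 1) (by omega)
      have h3 : φ (N + 1 + 1 : ℕ) = φ ((N + 1 : ℕ) + 1) := by rw [Nat.cast_add_one (N + 1)]
      rw [h3]
      simp only [hφ] at h1 ⊢
      linarith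
  have hφlim : Filter.Tendsto (fun N : ℕ => φ (N + 1 : ℕ)) Filter.atTop (nhds 0) := by
    have h1 := (tendsto_one_div_add_atTop_nhds_zero_nat (𝕜 := ℝ)).const_mul (1 / 4)
    rw [mul_zero] at h1
    refine squeeze_zero (fun N => (integral_vasyuninNear_mul_exp_mem (by positivity)).1)
      (fun N => ?_) h1
    have := (integral_vasyuninNear_mul_exp_mem (j := (N + 1 : ℕ)) (by positivity)).2
    push_cast at this ⊢
    exact this
  -- At infinity the constant difference is -log √π; at N = 1 the Stirling sequence is e/√2.
  have hstir := ((Filter.tendsto_add_atTop_iff_nat 1).2 Stirling.tendsto_stirlingSeq_sqrt_pi).log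
    (Real.sqrt_pos.2 Real.pi_pos).ne'
  have h := tendsto_nhds_unique ((hφlim.sub hstir).congr hstep) tendsto_const_nhds
  have hφ1 : φ 1 = ∫ t in Ioi 0, vasyuninNear t * Real.exp (-t) := by simp [hφ]
  rw [← hφ1, Real.log_mul two_ne_zero Real.pi_pos.ne']
  rw [Stirling.stirlingSeq_one, Real.log_div (Real.exp_pos 1).ne' (by positivity), Real.log_exp,
    Real.log_sqrt zero_le_two, Real.log_sqrt Real.pi_pos.le] at h
  linarith

/-- From B(t)e^{-t} = B(t) - e^{-t}, the left integrand minus B(t)/t minus e^{-t}/(2t) is the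
derivative of e^{-t}/t. -/
theorem integral_vasyuninNear_mul_exp_Ioi {d : ℝ} (hd : 0 < d) :
    ∫ t in Ioi d, vasyuninNear t * Real.exp (-t)
      = (∫ t in Ioi d, vasyuninFar t) - Real.exp (-d) / d
        + (∫ t in Ioi d, Real.exp (-t) / t) / 2 := by
  have hnear : IntegrableOn (fun t => vasyuninNear t * Real.exp (-t)) (Ioi d) := by
    simpa using (integrableOn_vasyuninNear_mul_exp one_pos).mono_set (Ioi_subset_Ioi hd.le)
  have hfar := integrableOn_vasyuninFar hd
  have hW := (integrableOn_exp_neg_div hd).div_const 2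
  have hsub : IntegrableOn (fun t => vasyuninNear t * Real.exp (-t) - vasyuninFar t) (Ioi d) :=
    hnear.sub hfar
  have hlim : Filter.Tendsto (fun t : ℝ => Real.exp (-t) / t) Filter.atTop (nhds 0) := by
    simpa [div_eq_mul_inv] using
      Real.tendsto_exp_neg_atTop_nhds_zero.mul tendsto_inv_atTop_zero
  have h := integral_Ioi_of_hasDerivAt_of_tendsto' (a := d) (f := fun t => Real.exp (-t) / t)
    (f' := fun t => vasyuninNear t * Real.exp (-t) - vasyuninFar t - Real.exp (-t) / t / 2)
    (fun t ht => by
      have h0 : 0 < t := hd.trans_le ht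
      refine ((hasDerivAt_neg t).exp.div (hasDerivAt_id t) h0.ne').congr_deriv ?_
      have hL : bose t * (1 - Real.exp (-t)) = Real.exp (-t) := by
        rw [bose_eq_exp_neg h0, div_mul_cancel₀ _ (one_sub_exp_neg_pos h0).ne']
      rw [vasyuninNear_eq_bose h0, vasyuninFar_eq]
      simp only [id]
      field_simp
      linear_combination (2 * t) * hL) (hsub.sub hW) hlim
  rw [integral_sub hsub hW, integral_sub hnear hfar, integral_div] at h
  linarith

-- As d → 0 the terms in 1/d and log d cancel, leaving 1 - (log 2π)/2 = -C + 1 - γ/2.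
open Filter Topology in
theorem vasyuninC_eq :
    vasyuninC = 1 / 2 * (Real.log (2 * Real.pi) - Real.eulerMascheroniConstant) := by
  have hnear : IntegrableOn (fun t => vasyuninNear t * Real.exp (-t)) (Ioi 0) := by
    simpa using integrableOn_vasyuninNear_mul_exp one_pos
  have h1 := tendsto_integral_Ioi_nhdsGT_zero hnear
  have h2 := (tendsto_integral_vasyuninFar.add tendsto_one_sub_exp_neg_div).add
    (tendsto_integral_exp_neg_div_add_log.div_const 2)
  have h := tendsto_nhds_unique h1 (h2.congr' ?_)
  · rw [integral_vasyuninNear_mul_exp_one] at h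
    linarith
  · filter_upwards [self_mem_nhdsWithin] with d hd
    rw [integral_vasyuninNear_mul_exp_Ioi hd]
    ring

/-! ### The regular part and the final formula -/

theorem integral_comp_mul_left_Ioi_real (f : ℝ → ℝ) {a : ℝ} (ha : 0 < a) (d : ℝ) :
    a * ∫ t in Ioi d, f (a * t) = ∫ t in Ioi (a * d), f t := by
  rw [integral_comp_mul_left_Ioi f d ha, smul_eq_mul, mul_inv_cancel_left₀ ha.ne']

/-- The elementary part of `m n E_m E_n`, once the odd parts of the partial fraction decomposition
are removed. -/
noncomputable def regularPart (a b t : ℝ) : ℝ :=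
  1 / t ^ 2 + (bose t ^ 2 + bose t) - a * b / 2 * (bose (a * t) + bose (b * t))
    - a ^ 2 * vasyuninFar (a * t) - b ^ 2 * vasyuninFar (b * t)

theorem mul_vasyuninE_mul {m n : ℕ} (hm : 1 ≤ m) (hn : 1 ≤ n) {u v : ℤ}
    (huv : (m : ℤ) * u + n * v = 1) {t : ℝ} (ht : 0 < t) :
    (m : ℝ) * n * (vasyuninE m t * vasyuninE n t)
      + m * n / 2 * (residueSum n u (Real.exp (-t)) + residueSum m v (Real.exp (-t)))
      = regularPart m n t := by
  have hm' : (0 : ℝ) < m := by exact_mod_cast hm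
  have hn' : (0 : ℝ) < n := by exact_mod_cast hn
  have h := bose_mul_bose hm hn huv ht
  have e : (m : ℝ) * n * (vasyuninE m t * vasyuninE n t)
      = 1 / t ^ 2 - m / t * bose (m * t) - n / t * bose (n * t)
        + m * n * (bose (m * t) * bose (n * t)) := by
    rw [vasyuninE_eq, vasyuninE_eq]
    field_simp
    ring
  rw [e, h, regularPart, vasyuninFar_eq, vasyuninFar_eq]
  field_simp
  ring

theorem integral_regularPart {a b d : ℝ} (ha : 0 < a) (hb : 0 < b) (hd : 0 < d) :
    ∫ t in Ioi d, regularPart a b t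
      = 1 / d + bose d + b / 2 * Real.log (1 - Real.exp (-(a * d)))
        + a / 2 * Real.log (1 - Real.exp (-(b * d)))
        - a * (∫ t in Ioi (a * d), vasyuninFar t) - b * ∫ t in Ioi (b * d), vasyuninFar t := by
  have i1 := integrableOn_inv_sq_Ioi hd
  have i2 := integrableOn_bose_sq_add hd
  have iB : ∀ {c : ℝ}, 0 < c → IntegrableOn (fun t => bose (c * t)) (Ioi d) := fun hc =>
    (integrableOn_Ioi_comp_mul_left_iff bose d hc).2 (integrableOn_bose (mul_pos hc hd))
  have iF : ∀ {c : ℝ}, 0 < c → IntegrableOn (fun t => c ^ 2 * vasyuninFar (c * t)) (Ioi d) :=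
    fun {c} hc => ((integrableOn_Ioi_comp_mul_left_iff vasyuninFar d hc).2
      (integrableOn_vasyuninFar (mul_pos hc hd))).const_mul (c ^ 2)
  have i3 : IntegrableOn (fun t => a * b / 2 * (bose (a * t) + bose (b * t))) (Ioi d) :=
    ((iB ha).add (iB hb)).const_mul (a * b / 2)
  have i12 : IntegrableOn (fun t => 1 / t ^ 2 + (bose t ^ 2 + bose t)) (Ioi d) := i1.add i2
  have i123 : IntegrableOn (fun t => 1 / t ^ 2 + (bose t ^ 2 + bose t)
      - a * b / 2 * (bose (a * t) + bose (b * t))) (Ioi d) := i12.sub i3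
  have i1234 : IntegrableOn (fun t => 1 / t ^ 2 + (bose t ^ 2 + bose t)
      - a * b / 2 * (bose (a * t) + bose (b * t)) - a ^ 2 * vasyuninFar (a * t)) (Ioi d) :=
    i123.sub (iF ha)
  have vB : ∀ {c : ℝ}, 0 < c → c * ∫ t in Ioi d, bose (c * t)
      = -Real.log (1 - Real.exp (-(c * d))) := fun {c} hc => by
    rw [integral_comp_mul_left_Ioi_real bose hc, integral_bose (mul_pos hc hd)]
  unfold regularPart
  rw [integral_sub i1234 (iF hb), integral_sub i123 (iF ha), integral_sub i12 i3,
    integral_add i1 i2,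
    integral_const_mul, integral_add (iB ha) (iB hb), integral_const_mul, integral_const_mul,
    integral_inv_sq_Ioi hd, integral_bose_sq_add hd,
    ← integral_comp_mul_left_Ioi_real vasyuninFar ha,
    ← integral_comp_mul_left_Ioi_real vasyuninFar hb]
  linear_combination (-b / 2) * vB ha - a / 2 * vB hb

-- The poles cancel as 1/d + 1/d - a/(ad) - b/(bd). The logarithms carry weights b/2 - a/2 at ad and
-- a/2 - b/2 at bd, so log d drops out and (a - b)/2 · log(b/a) survives.
open Filter Topology in
theorem tendsto_integral_regularPart {a b : ℝ} (ha : 0 < a) (hb : 0 < b) :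
    Tendsto (fun d => ∫ t in Ioi d, regularPart a b t) (𝓝[>] 0)
      (𝓝 (-(1 / 2) + vasyuninC * (b + a) + (a - b) / 2 * Real.log (b / a))) := by
  have sa := tendsto_mul_left_nhdsGT_zero ha
  have sb := tendsto_mul_left_nhdsGT_zero hb
  have hℓ := tendsto_log_one_sub_exp_neg_sub_log
  have hK := tendsto_integral_vasyuninFar
  have h := (((tendsto_bose_sub_inv.add (((hℓ.comp sa).const_mul (b / 2)).add
    ((hℓ.comp sb).const_mul (a / 2)))).sub ((hK.comp sa).const_mul a)).sub
      ((hK.comp sb).const_mul b)).add_const ((a - b) / 2 * Real.log (b / a))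
  convert! h.congr' ?_ using 2
  · ring
  · filter_upwards [self_mem_nhdsWithin] with d hd
    have hd : 0 < d := hd
    simp only [Function.comp_apply]
    rw [integral_regularPart ha hb hd, Real.log_mul ha.ne' hd.ne', Real.log_mul hb.ne' hd.ne',
      Real.log_div hb.ne' ha.ne']
    field_simp
    ring

theorem integral_vasyuninE_mul {m n : ℕ} (hm : 1 ≤ m) (hn : 1 ≤ n) (hmn : Nat.Coprime m n) :
    (m : ℝ) * (n : ℝ) * (∫ t in Ioi (0 : ℝ), vasyuninE m t * vasyuninE n t) =
      -(1 / 2 : ℝ) + vasyuninC * ((n : ℝ) + (m : ℝ))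
        + ((m : ℝ) - (n : ℝ)) / 2 * Real.log ((n : ℝ) / (m : ℝ))
        - Real.pi / 2 * (∑ k ∈ Finset.Icc 1 (n - 1),
            (m : ℝ) * (k : ℝ) / (n : ℝ) * Real.cot ((m : ℝ) * (k : ℝ) * Real.pi / (n : ℝ)))
        - Real.pi / 2 * (∑ l ∈ Finset.Icc 1 (m - 1),
            (n : ℝ) * (l : ℝ) / (m : ℝ) *
              Real.cot ((n : ℝ) * (l : ℝ) * Real.pi / (m : ℝ))) := by
  obtain ⟨u, v, huv⟩ := Nat.isCoprime_iff_coprime.2 hmn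
  have huv : (m : ℤ) * u + n * v = 1 := by linarith
  have hvu : (n : ℤ) * v + m * u = 1 := by linarith
  have hm' : (0 : ℝ) < m := by exact_mod_cast hm
  have hn' : (0 : ℝ) < n := by exact_mod_cast hn
  have hE := (integrableOn_vasyuninE_mul hm hn).const_mul ((m : ℝ) * n)
  have hS : IntegrableOn (fun t => (m : ℝ) * n / 2 *
      (residueSum n u (Real.exp (-t)) + residueSum m v (Real.exp (-t)))) (Ioi 0) :=
    ((integrableOn_residueSum n u).add (integrableOn_residueSum m v)).const_mul _
  -- The individual terms of `regularPart` diverge at 0; integrability of the whole is inherited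
  -- from the other side of the identity, so the limit of the truncated integrals is the full
  -- integral.
  have hR : IntegrableOn (regularPart m n) (Ioi 0) :=
    IntegrableOn.congr_fun (hE.add hS) (fun t ht => mul_vasyuninE_mul hm hn huv ht) measurableSet_Ioi
  have hval := tendsto_nhds_unique (tendsto_integral_Ioi_nhdsGT_zero hR)
    (tendsto_integral_regularPart hm' hn')
  rw [← setIntegral_congr_fun measurableSet_Ioi
      (fun t ht => mul_vasyuninE_mul hm hn huv (show 0 < t from ht)), integral_add hE hS,
    integral_const_mul, integral_const_mul,
    integral_add (integrableOn_residueSum n u) (integrableOn_residueSum m v),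
    integral_residueSum, integral_residueSum, sum_residueFract_mul_cot huv,
    sum_residueFract_mul_cot hvu] at hval
  have hsum : ∀ a b : ℕ, ∑ k ∈ Finset.Icc 1 (b - 1),
      (a : ℝ) * k / b * Real.cot ((a : ℝ) * k * Real.pi / b)
        = a * ∑ k ∈ Finset.Icc 1 (b - 1), (k : ℝ) / b * Real.cot ((a : ℝ) * k * Real.pi / b) := by
    intro a b
    rw [Finset.mul_sum]
    exact Finset.sum_congr rfl fun k _ => by ring
  rw [hsum, hsum, eq_sub_iff_add_eq, eq_sub_iff_add_eq, ← hval]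
  field_simp
  ring

theorem mainTheorem1 :
    (IntegrableOn vasyuninNear (Ioc (0 : ℝ) 1) volume ∧
      IntegrableOn vasyuninFar (Ioi (1 : ℝ)) volume ∧
      vasyuninC = (1 / 2 : ℝ) * (Real.log (2 * Real.pi) - Real.eulerMascheroniConstant)) ∧
    ∀ m n : ℕ, 1 ≤ m → 1 ≤ n → Nat.Coprime m n →
      IntegrableOn (fun t : ℝ => vasyuninE m t * vasyuninE n t) (Ioi (0 : ℝ)) volume ∧
      (m : ℝ) * (n : ℝ) * (∫ t in Ioi (0 : ℝ), vasyuninE m t * vasyuninE n t) =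
        -(1 / 2 : ℝ) + vasyuninC * ((n : ℝ) + (m : ℝ))
          + ((m : ℝ) - (n : ℝ)) / 2 * Real.log ((n : ℝ) / (m : ℝ))
          - Real.pi / 2 * (∑ k ∈ Finset.Icc 1 (n - 1),
              (m : ℝ) * (k : ℝ) / (n : ℝ) * Real.cot ((m : ℝ) * (k : ℝ) * Real.pi / (n : ℝ)))
          - Real.pi / 2 * (∑ l ∈ Finset.Icc 1 (m - 1),
              (n : ℝ) * (l : ℝ) / (m : ℝ) * Real.cot ((n : ℝ) * (l : ℝ) * Real.pi / (m : ℝ))) :=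
  ⟨⟨integrableOn_vasyuninNear le_rfl 1, integrableOn_vasyuninFar one_pos, vasyuninC_eq⟩,
    fun _ _ hm hn hmn => ⟨integrableOn_vasyuninE_mul hm hn, integral_vasyuninE_mul hm hn hmn⟩⟩
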